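/- Let $k,n\ge 1$, let $M_{kn\times n}$ be the space of real $kn\times n$ matrices and $\mathfrak{gl}(kn)$ the space of real $kn\times kn$ matrices. A $(k-1)$-jet of fanning frames (at a fixed instant) is a tuple $(A,\dot A,\dots,A^{(k-1)})$ of matrices in $M_{kn\times n}$ such that the juxtaposed $kn\times kn$ matrix $(A|\dot A|\cdots|A^{(k-1)})$ is invertible; these tuples form an open set $J^{k-1}_f(\mathbb R;M_{kn\times n})$ of $(M_{kn\times n})^k$. The group $J^{k-1}(\mathbb R;GL(n))$ of $(k-1)$-jets $(X,\dot X,\dots,X^{(k-1)})$ of curves of invertible $n\times n$ matrices ($X$ invertible) acts on it on the right by Leibniz's rule, $(A\cdot X)^{(r)}=\sum_{i=0}^{r}\binom ri A^{(r-i)}X^{(i)}$. The space of $(k-1)$-jets of fanning curves $J^{k-1}_f(\mathbb R;Gr(n,\mathbb R^{kn}))$ is the quotient by this action, a smooth manifold for which the quotient projection is a smooth submersion. The group $GL(kn)$ acts on it through $T\cdot(A,\dot A,\dots,A^{(k-1)})=(TA,T\dot A,\dots,TA^{(k-1)})$. The fundamental endomorphism $$F:J^{k-1}_f(\mathbb R;Gr(n,\mathbb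 R^{kn}))\to\mathfrak{gl}(kn)$$ sends the class of $(A,\dot A,\dots,A^{(k-1)})$ to the unique matrix $F$ with $FA=0$ and $FA^{(i)}=i\,A^{(i-1)}$ for $1\le i\le k-1$; this does not depend on the representative. **Proposition.** The map $F$ is equivariant, $F(T\cdot s)=T\,F(s)\,T^{-1}$ for all $T\in GL(kn)$, and it is a smooth embedding (an immersion and a homeomorphism onto its image, hence a diffeomorphism onto its image) whose image is an orbit of the adjoint action of $GL(kn)$ on $\mathfrak{gl}(kn)$. Moreover the isotropy groups of a jet and of its image coincide: $T\cdot s=s$ if and only if $T\,F(s)\,T^{-1}=F(s)$. -/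

import Mathlib

open scoped Manifold ContDiff MatrixGroups

namespace FanningJets

/-- The square matrix `(A₀ | A₁ | ⋯ | A_{k-1})` obtained by juxtaposing `k` matrices of size
`kn × n`.  Rows and columns of `kn × kn` matrices are indexed by `Fin k × Fin n`: the pair
`(i, a)` is position `a` of the `i`-th block of length `n`. -/
def juxtapose {k n : ℕ} (A : Fin k → Matrix (Fin k × Fin n) (Fin n) ℝ) :
    Matrix (Fin k × Fin n) (Fin k × Fin n) ℝ :=
  Matrix.of fun p q => A q.1 p q.2

/-- The product of two jets by Leibniz's rule:
`(A · X)ᵣ = ∑_{i ≤ r} (r choose i) A_{r-i} X_i`,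
where index `i` stands for the `i`-th derivative. -/
def leibniz {k n : ℕ} {m : Type*} (A : Fin k → Matrix m (Fin n) ℝ)
    (X : Fin k → Matrix (Fin n) (Fin n) ℝ) : Fin k → Matrix m (Fin n) ℝ := fun r =>
  ∑ i ∈ Finset.Iic r, (r.1.choose i.1 : ℝ) • (A ⟨r.1 - i.1, by omega⟩ * X i)

/-- The block upper triangular matrix whose block in position `(j, r)` is
`(r choose j) X_{r-j}` for `j ≤ r` and zero otherwise (the binomial coefficient vanishes). -/
def toeplitz {k n : ℕ} (X : Fin k → Matrix (Fin n) (Fin n) ℝ) :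
    Matrix (Fin k × Fin n) (Fin k × Fin n) ℝ :=
  Matrix.of fun p q => (q.1.1.choose p.1.1 : ℝ) * X ⟨q.1.1 - p.1.1, by omega⟩ p.2 q.2

/-- The nilpotent matrix with blocks `I, 2 I, …, (k-1) I` directly above the block diagonal and
zeros elsewhere. -/
def nilp (k n : ℕ) : Matrix (Fin k × Fin n) (Fin k × Fin n) ℝ :=
  Matrix.of fun p q => if p.1.1 + 1 = q.1.1 ∧ p.2 = q.2 then (q.1.1 : ℝ) else 0

theorem leibniz_eq {k n : ℕ} {m : Type*} (A : Fin k → Matrix m (Fin n) ℝ)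
    (X : Fin k → Matrix (Fin n) (Fin n) ℝ) (r : Fin k) :
    leibniz A X r = ∑ j : Fin k, (r.1.choose j.1 : ℝ) • (A j * X ⟨r.1 - j.1, by omega⟩) := by
  have h0 : ∑ j ∈ Finset.Iic r, (r.1.choose j.1 : ℝ) • (A j * X ⟨r.1 - j.1, by omega⟩) =
      ∑ j : Fin k, (r.1.choose j.1 : ℝ) • (A j * X ⟨r.1 - j.1, by omega⟩) := by
    refine Finset.sum_subset (Finset.subset_univ (Finset.Iic r)) fun j _ hj => ?_
    simp only [Finset.mem_Iic, Fin.le_def, not_le] at hj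
    simp [Nat.choose_eq_zero_of_lt hj]
  rw [← h0, leibniz]
  let σ : Fin k → Fin k := fun i => ⟨r.1 - i.1, by omega⟩
  have hσ : ∀ i ∈ Finset.Iic r, σ (σ i) = i := by
    intro i hi
    simp only [Finset.mem_Iic, Fin.le_def] at hi
    ext; simp only [σ]; omega
  have hm : ∀ i ∈ Finset.Iic r, σ i ∈ Finset.Iic r := by
    intro i _
    simp only [Finset.mem_Iic, Fin.le_def, σ]; omega
  refine Finset.sum_bij' (fun i _ => σ i) (fun i _ => σ i) hm hm hσ hσ ?_
  intro i hi
  have h1 : (⟨r.1 - (σ i).1, by omega⟩ : Fin k) = i := hσ i hi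
  simp only [Finset.mem_Iic, Fin.le_def] at hi
  rw [h1]
  simp only [σ, Nat.choose_symm hi]

theorem leibniz_apply {k n : ℕ} {m : Type*} (A : Fin k → Matrix m (Fin n) ℝ)
    (X : Fin k → Matrix (Fin n) (Fin n) ℝ) (r : Fin k) (p : m) (b : Fin n) :
    leibniz A X r p b = ∑ q : Fin k × Fin n, A q.1 p q.2 * toeplitz X q (r, b) := by
  rw [leibniz_eq, Matrix.sum_apply, Fintype.sum_prod_type]
  refine Finset.sum_congr rfl fun j _ => ?_
  simp only [Matrix.smul_apply, Matrix.mul_apply, smul_eq_mul, Finset.mul_sum, toeplitz,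
    Matrix.of_apply]
  refine Finset.sum_congr rfl fun a _ => ?_
  ring

theorem juxtapose_leibniz {k n : ℕ} (A : Fin k → Matrix (Fin k × Fin n) (Fin n) ℝ)
    (X : Fin k → Matrix (Fin n) (Fin n) ℝ) :
    juxtapose (leibniz A X) = juxtapose A * toeplitz X := by
  ext p q
  simp only [juxtapose, Matrix.of_apply, leibniz_apply, Matrix.mul_apply]

theorem mul_nilp_zero {k n : ℕ} (M : Matrix (Fin k × Fin n) (Fin k × Fin n) ℝ)
    (p : Fin k × Fin n) (h : 0 < k) (b : Fin n) : (M * nilp k n) p (⟨0, h⟩, b) = 0 := by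
  rw [Matrix.mul_apply]
  exact Finset.sum_eq_zero fun q _ => by simp [nilp]

theorem mul_nilp_succ {k n : ℕ} (M : Matrix (Fin k × Fin n) (Fin k × Fin n) ℝ)
    (p : Fin k × Fin n) (r : ℕ) (h : r + 1 < k) (b : Fin n) :
    (M * nilp k n) p (⟨r + 1, h⟩, b) = (r + 1 : ℝ) * M p (⟨r, by omega⟩, b) := by
  rw [Matrix.mul_apply, Finset.sum_eq_single (⟨r, by omega⟩, b)]
  · simp [nilp, mul_comm]
  · rintro ⟨j, c⟩ - hne
    have : ¬ (j.1 + 1 = r + 1 ∧ c = b) := by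
      rintro ⟨h1, rfl⟩
      exact hne (by ext <;> simp; omega)
    rw [nilp, Matrix.of_apply, if_neg this, mul_zero]
  · simp

theorem nilp_mul_last {k n : ℕ} (M : Matrix (Fin k × Fin n) (Fin k × Fin n) ℝ)
    (i : Fin k) (hi : k ≤ i.1 + 1) (a : Fin n) (q : Fin k × Fin n) :
    (nilp k n * M) (i, a) q = 0 := by
  rw [Matrix.mul_apply]
  refine Finset.sum_eq_zero fun p _ => ?_
  have : ¬ (i.1 + 1 = p.1.1 ∧ a = p.2) := by have := p.1.2; omega
  simp [nilp, this]

theorem nilp_mul {k n : ℕ} (M : Matrix (Fin k × Fin n) (Fin k × Fin n) ℝ)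
    (i : ℕ) (hi : i + 1 < k) (a : Fin n) (q : Fin k × Fin n) :
    (nilp k n * M) (⟨i, by omega⟩, a) q = (i + 1 : ℝ) * M (⟨i + 1, hi⟩, a) q := by
  rw [Matrix.mul_apply, Finset.sum_eq_single (⟨i + 1, hi⟩, a)]
  · simp [nilp]
  · rintro ⟨j, c⟩ - hne
    have : ¬ (i + 1 = j.1 ∧ a = c) := by
      rintro ⟨h1, rfl⟩
      exact hne (by ext <;> simp; omega)
    simp [nilp, this]
  · simp

theorem toeplitz_comm {k n : ℕ} (X : Fin k → Matrix (Fin n) (Fin n) ℝ) :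
    toeplitz X * nilp k n = nilp k n * toeplitz X := by
  ext ⟨⟨i, hi⟩, a⟩ ⟨⟨r, hr⟩, b⟩
  rcases r with _ | r
  · rw [mul_nilp_zero]
    by_cases h : i + 1 < k
    · rw [nilp_mul _ i h]
      simp [toeplitz]
    · rw [nilp_mul_last _ _ (by simpa using h)]
  · rw [mul_nilp_succ]
    by_cases h : i + 1 < k
    · rw [nilp_mul _ i h]
      have hc := Nat.add_one_mul_choose_eq r i
      have hc' : ((r : ℝ) + 1) * (r.choose i : ℝ) = ((r + 1).choose (i + 1) : ℝ) * (i + 1) := by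
        exact_mod_cast hc
      simp only [toeplitz, Matrix.of_apply, Nat.add_sub_add_right]
      rw [← mul_assoc, hc']
      ring
    · rw [nilp_mul_last _ _ (by simpa using h)]
      simp [toeplitz, Nat.choose_eq_zero_of_lt (show r < i by omega)]

/-- The first block row of a matrix, as a `k`-tuple of `n × n` matrices. -/
def row {k n : ℕ} [NeZero k] (M : Matrix (Fin k × Fin n) (Fin k × Fin n) ℝ) :
    Fin k → Matrix (Fin n) (Fin n) ℝ := fun i => Matrix.of fun a b => M (0, a) (i, b)

theorem row_toeplitz {k n : ℕ} [NeZero k] (X : Fin k → Matrix (Fin n) (Fin n) ℝ) :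
    row (toeplitz X) = X := by
  ext i a b
  simp [row, toeplitz]

theorem toeplitz_row_of_comm {k n : ℕ} [NeZero k] {M : Matrix (Fin k × Fin n) (Fin k × Fin n) ℝ}
    (h : M * nilp k n = nilp k n * M) : toeplitz (row M) = M := by
  have key : ∀ (i : ℕ) (hi : i < k) (r : ℕ) (hr : r < k) (a b : Fin n),
      toeplitz (row M) (⟨i, hi⟩, a) (⟨r, hr⟩, b) = M (⟨i, hi⟩, a) (⟨r, hr⟩, b) := by
    intro i
    induction i with
    | zero =>
      intro hi r hr a b
      have h0 : (⟨0, hi⟩ : Fin k) = 0 := by ext; simp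
      simp [toeplitz, row, h0]
    | succ i ih =>
      intro hi r hr a b
      have hpos : (i + 1 : ℝ) ≠ 0 := by positivity
      apply mul_left_cancel₀ hpos
      rw [← nilp_mul _ i hi, ← nilp_mul _ i hi, ← h, ← toeplitz_comm]
      rcases r with _ | r
      · rw [mul_nilp_zero, mul_nilp_zero]
      · rw [mul_nilp_succ, mul_nilp_succ, ih]
  ext ⟨⟨i, hi⟩, a⟩ ⟨⟨r, hr⟩, b⟩
  exact key i hi r hr a b

theorem row_mul_toeplitz {k n : ℕ} [NeZero k] (M : Matrix (Fin k × Fin n) (Fin k × Fin n) ℝ)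
   (X : Fin k → Matrix (Fin n) (Fin n) ℝ) :
    row (M * toeplitz X) = leibniz (row M) X := by
  ext i a b
  simp only [row, Matrix.of_apply, leibniz_apply, Matrix.mul_apply]

theorem toeplitz_leibniz {k n : ℕ} [NeZero k] (X Y : Fin k → Matrix (Fin n) (Fin n) ℝ) :
    toeplitz (leibniz X Y) = toeplitz X * toeplitz Y := by
  have h : toeplitz X * toeplitz Y * nilp k n = nilp k n * (toeplitz X * toeplitz Y) := by
    rw [Matrix.mul_assoc, toeplitz_comm, ← Matrix.mul_assoc, toeplitz_comm, Matrix.mul_assoc]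
  rw [← toeplitz_row_of_comm h, row_mul_toeplitz, row_toeplitz]

theorem isUnit_toeplitz {k n : ℕ} [NeZero k] (X : Fin k → Matrix (Fin n) (Fin n) ℝ) :
    IsUnit (toeplitz X) ↔ IsUnit (X 0) := by
  have h1 : (toeplitz X).BlockTriangular Prod.fst := by
    rintro ⟨i, a⟩ ⟨j, b⟩ hij
    have hij' : j.1 < i.1 := hij
    simp [toeplitz, Nat.choose_eq_zero_of_lt hij']
  have h2 : ∀ i : Fin k, ((toeplitz X).toSquareBlock Prod.fst i).det = (X 0).det := by
    intro i
    let e : Fin n ≃ {p : Fin k × Fin n // p.1 = i} :=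
      { toFun := fun a => ⟨(i, a), rfl⟩
        invFun := fun p => p.1.2
        left_inv := fun a => rfl
        right_inv := by rintro ⟨⟨j, a⟩, rfl⟩; rfl }
    rw [← Matrix.det_submatrix_equiv_self e]
    congr 1
    ext a b
    simp [e, Matrix.toSquareBlock, Matrix.toSquareBlockProp, toeplitz]
  rw [Matrix.isUnit_iff_isUnit_det, Matrix.isUnit_iff_isUnit_det, h1.det_fintype]
  simp only [h2, Finset.prod_const, Finset.card_univ, Fintype.card_fin]
  exact isUnit_pow_iff (NeZero.ne k)

/-- The `(k-1)`-jets (at a fixed instant) of smooth curves of invertible `n × n` matrices: tuples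
`(X₀, …, X_{k-1})` of successive derivatives with `X₀` invertible.  It is a group under Leibniz's
rule. -/
def JetGL (k n : ℕ) [NeZero k] : Type :=
  {X : Fin k → Matrix (Fin n) (Fin n) ℝ // IsUnit (X 0)}

namespace JetGL

variable {k n : ℕ} [NeZero k]

instance : Mul (JetGL k n) :=
  ⟨fun X Y => ⟨leibniz X.1 Y.1, by
    rw [← isUnit_toeplitz, toeplitz_leibniz]
    exact ((isUnit_toeplitz _).2 X.2).mul ((isUnit_toeplitz _).2 Y.2)⟩⟩

instance : One (JetGL k n) := ⟨⟨fun i => if i = 0 then 1 else 0, by simp⟩⟩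

theorem toeplitz_inv (X : JetGL k n) : toeplitz (row (toeplitz X.1)⁻¹) = (toeplitz X.1)⁻¹ := by
  have hu : IsUnit (toeplitz X.1).det :=
    (Matrix.isUnit_iff_isUnit_det _).1 ((isUnit_toeplitz _).2 X.2)
  apply toeplitz_row_of_comm
  calc (toeplitz X.1)⁻¹ * nilp k n
      = (toeplitz X.1)⁻¹ * (nilp k n * toeplitz X.1) * (toeplitz X.1)⁻¹ := by
        rw [Matrix.mul_assoc, Matrix.mul_assoc, Matrix.mul_nonsing_inv _ hu, Matrix.mul_one]
    _ = nilp k n * (toeplitz X.1)⁻¹ := by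
        rw [← toeplitz_comm, ← Matrix.mul_assoc, Matrix.nonsing_inv_mul _ hu, Matrix.one_mul]

noncomputable instance : Inv (JetGL k n) :=
  ⟨fun X => ⟨row (toeplitz X.1)⁻¹, by
    rw [← isUnit_toeplitz, toeplitz_inv]
    exact (Matrix.isUnit_nonsing_inv_iff).2 ((isUnit_toeplitz _).2 X.2)⟩⟩

theorem toeplitz_mul (X Y : JetGL k n) : toeplitz (X * Y).1 = toeplitz X.1 * toeplitz Y.1 :=
  toeplitz_leibniz X.1 Y.1

theorem toeplitz_one : toeplitz (1 : JetGL k n).1 = 1 := by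
  have h : toeplitz (row (1 : Matrix (Fin k × Fin n) (Fin k × Fin n) ℝ)) = 1 :=
    toeplitz_row_of_comm (by simp)
  have h' : (1 : JetGL k n).1 = row (1 : Matrix (Fin k × Fin n) (Fin k × Fin n) ℝ) := by
    funext i
    change (if i = 0 then (1 : Matrix (Fin n) (Fin n) ℝ) else 0) = _
    ext a b
    by_cases hi : i = 0
    · subst hi; simp [row, Matrix.one_apply]
    · simp [row, hi, Ne.symm hi]
  rw [h', h]

theorem ext_toeplitz {X Y : JetGL k n} (h : toeplitz X.1 = toeplitz Y.1) : X = Y :=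
  Subtype.ext (by rw [← row_toeplitz X.1, h, row_toeplitz])

noncomputable instance : Group (JetGL k n) where
  mul_assoc X Y Z := ext_toeplitz (by simp only [toeplitz_mul, Matrix.mul_assoc])
  one_mul X := ext_toeplitz (by rw [toeplitz_mul, toeplitz_one, Matrix.one_mul])
  mul_one X := ext_toeplitz (by rw [toeplitz_mul, toeplitz_one, Matrix.mul_one])
  inv_mul_cancel X := ext_toeplitz (by
    rw [toeplitz_mul, toeplitz_one]
    change toeplitz (row (toeplitz X.1)⁻¹) * _ = 1
    rw [toeplitz_inv]
    exact Matrix.nonsing_inv_mul _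
      ((Matrix.isUnit_iff_isUnit_det _).1 ((isUnit_toeplitz _).2 X.2)))

end JetGL

theorem juxtapose_injective {k n : ℕ} :
    Function.Injective (juxtapose : (Fin k → Matrix (Fin k × Fin n) (Fin n) ℝ) → _) := by
  intro A B h
  ext i p b
  exact congrFun (congrFun h p) (i, b)

theorem isOpen_isUnit (ι : Type) [Fintype ι] [DecidableEq ι] :
    IsOpen {M : Matrix ι ι ℝ | IsUnit M} := by
  simp only [Matrix.isUnit_iff_isUnit_det, isUnit_iff_ne_zero]
  exact isOpen_ne_fun (Continuous.matrix_det continuous_id) continuous_const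

theorem continuous_juxtapose {k n : ℕ} :
    Continuous (juxtapose : (Fin k → Matrix (Fin k × Fin n) (Fin n) ℝ) → _) := by
  refine continuous_matrix fun p q => ?_
  exact (continuous_apply_apply p q.2).comp (continuous_apply q.1)

/-- The open set of `k`-tuples of `kn × n` matrices (given by their entries) for which the
juxtaposed `kn × kn` matrix is invertible. -/
def fanningSet (k n : ℕ) : TopologicalSpace.Opens (Fin k → Fin k × Fin n → Fin n → ℝ) :=
  ⟨{A | IsUnit (juxtapose fun i => Matrix.of (A i))},
    (isOpen_isUnit _).preimage continuous_juxtapose⟩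

/-- The space of `(k-1)`-jets (at a fixed instant) of fanning frames: tuples
`(A, A', …, A^{(k-1)})` of `kn × n` matrices with `(A | A' | ⋯ | A^{(k-1)})` invertible.  It is a
manifold as an open subset of the vector space of all tuples. -/
def FrameJet (k n : ℕ) : Type := fanningSet k n

instance {k n : ℕ} : TopologicalSpace (FrameJet k n) :=
  inferInstanceAs (TopologicalSpace (fanningSet k n))

noncomputable instance {k n : ℕ} :
    ChartedSpace (Fin k → Fin k × Fin n → Fin n → ℝ) (FrameJet k n) :=
  inferInstanceAs (ChartedSpace _ (fanningSet k n))

instance {k n : ℕ} :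
    IsManifold 𝓘(ℝ, Fin k → Fin k × Fin n → Fin n → ℝ) ∞ (FrameJet k n) :=
  inferInstanceAs (IsManifold 𝓘(ℝ, Fin k → Fin k × Fin n → Fin n → ℝ) ∞ (fanningSet k n))

/-- The tuple of derivatives `(A, A', …, A^{(k-1)})` of a jet of fanning frames. -/
def derivs {k n : ℕ} (A : FrameJet k n) : Fin k → Matrix (Fin k × Fin n) (Fin n) ℝ :=
  fun i => Matrix.of (A.1 i)

/-- The jet of fanning frames with prescribed derivatives. -/
def ofDerivs {k n : ℕ} (A : Fin k → Matrix (Fin k × Fin n) (Fin n) ℝ)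
    (h : IsUnit (juxtapose A)) : FrameJet k n :=
  ⟨fun i p b => A i p b, h⟩

theorem derivs_ofDerivs {k n : ℕ} (A : Fin k → Matrix (Fin k × Fin n) (Fin n) ℝ)
    (h : IsUnit (juxtapose A)) : derivs (ofDerivs A h) = A := rfl

theorem isUnit_derivs {k n : ℕ} (A : FrameJet k n) : IsUnit (juxtapose (derivs A)) := A.2

theorem continuous_derivs {k n : ℕ} :
    Continuous fun A : FrameJet k n => juxtapose (derivs A) :=
  continuous_juxtapose.comp continuous_subtype_val

theorem FrameJet.ext_juxtapose {k n : ℕ} {A B : FrameJet k n}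
    (h : juxtapose (derivs A) = juxtapose (derivs B)) : A = B :=
  Subtype.ext (juxtapose_injective h)

theorem juxtapose_left_mul {k n : ℕ} (T : Matrix (Fin k × Fin n) (Fin k × Fin n) ℝ)
    (A : Fin k → Matrix (Fin k × Fin n) (Fin n) ℝ) :
    juxtapose (fun i => T * A i) = T * juxtapose A := by
  ext p q
  simp [juxtapose, Matrix.mul_apply]

/-- The linear action `T · (A, A', …) = (T A, T A', …)`. -/
instance {k n : ℕ} : MulAction (GL (Fin k × Fin n) ℝ) (FrameJet k n) where
  smul T A := ofDerivs (fun i => T.1 * derivs A i) (by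
    rw [juxtapose_left_mul]
    exact T.isUnit.mul (isUnit_derivs A))
  one_smul A := Subtype.ext (funext fun i => Matrix.one_mul _)
  mul_smul T S A := Subtype.ext (funext fun i => Matrix.mul_assoc _ _ _)

/-- The right action of the jet group on jets of fanning frames by Leibniz's rule, as a left
action of the opposite group. -/
instance {k n : ℕ} [NeZero k] : MulAction (JetGL k n)ᵐᵒᵖ (FrameJet k n) where
  smul X A := ofDerivs (leibniz (derivs A) X.unop.1) (by
    rw [juxtapose_leibniz]
    exact (isUnit_derivs A).mul ((isUnit_toeplitz _).2 X.unop.2))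
  one_smul A := FrameJet.ext_juxtapose (by
    change juxtapose (leibniz (derivs A) (1 : JetGL k n).1) = _
    rw [juxtapose_leibniz, JetGL.toeplitz_one, Matrix.mul_one])
  mul_smul X Y A := FrameJet.ext_juxtapose (by
    change juxtapose (leibniz (derivs A) (Y.unop * X.unop).1) =
      juxtapose (leibniz (leibniz (derivs A) Y.unop.1) X.unop.1)
    simp only [juxtapose_leibniz, JetGL.toeplitz_mul, Matrix.mul_assoc])

/-- The matrix `(A | ⋯ | A^{(k-1)}) N (A | ⋯ | A^{(k-1)})⁻¹` of the fundamental endomorphism of a jet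
of fanning frames.  By the three lemmas below it is the only matrix `F` with `F A = 0` and
`F A^{(i)} = i A^{(i-1)}` for `1 ≤ i ≤ k - 1`. -/
noncomputable def frameEnd {k n : ℕ} (A : FrameJet k n) :
    Matrix (Fin k × Fin n) (Fin k × Fin n) ℝ :=
  juxtapose (derivs A) * nilp k n * (juxtapose (derivs A))⁻¹

theorem mul_derivs_apply {k n : ℕ} (M : Matrix (Fin k × Fin n) (Fin k × Fin n) ℝ)
    (A : FrameJet k n) (i : Fin k) (p : Fin k × Fin n) (b : Fin n) :
    (M * derivs A i) p b = (M * juxtapose (derivs A)) p (i, b) := by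
  simp [Matrix.mul_apply, juxtapose]

theorem frameEnd_mul_juxtapose {k n : ℕ} (A : FrameJet k n) :
    frameEnd A * juxtapose (derivs A) = juxtapose (derivs A) * nilp k n := by
  rw [frameEnd, Matrix.mul_assoc, Matrix.nonsing_inv_mul _
    ((Matrix.isUnit_iff_isUnit_det _).1 (isUnit_derivs A)), Matrix.mul_one]

theorem frameEnd_mul_derivs_zero {k n : ℕ} (A : FrameJet k n) (h : 0 < k) :
    frameEnd A * derivs A ⟨0, h⟩ = 0 := by
  ext p b
  rw [mul_derivs_apply, frameEnd_mul_juxtapose, mul_nilp_zero, Matrix.zero_apply]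

theorem frameEnd_mul_derivs_succ {k n : ℕ} (A : FrameJet k n) (i : ℕ) (h : i + 1 < k) :
    frameEnd A * derivs A ⟨i + 1, h⟩ = (i + 1 : ℝ) • derivs A ⟨i, by omega⟩ := by
  ext p b
  rw [mul_derivs_apply, frameEnd_mul_juxtapose, mul_nilp_succ, Matrix.smul_apply, smul_eq_mul]
  rfl

theorem frameEnd_unique {k n : ℕ} (A : FrameJet k n)
    (F : Matrix (Fin k × Fin n) (Fin k × Fin n) ℝ)
    (h : ∀ i, F * derivs A i = frameEnd A * derivs A i) : F = frameEnd A := by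
  have h' : F * juxtapose (derivs A) = frameEnd A * juxtapose (derivs A) := by
    ext p ⟨i, b⟩
    rw [← mul_derivs_apply, ← mul_derivs_apply, h]
  exact (isUnit_derivs A).mul_right_cancel h'

/-- The space of `(k-1)`-jets of fanning curves in the Grassmannian of `n`-planes of `ℝ^{kn}`: the
quotient of the space of `(k-1)`-jets of fanning frames by the action of the group of `(k-1)`-jets
of curves of invertible `n × n` matrices. -/
def GrJet (k n : ℕ) [NeZero k] : Type :=
  MulAction.orbitRel.Quotient (JetGL k n)ᵐᵒᵖ (FrameJet k n)

namespace GrJet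
variable {k n : ℕ} [NeZero k]

instance : TopologicalSpace (GrJet k n) :=
  inferInstanceAs (TopologicalSpace (Quotient (MulAction.orbitRel (JetGL k n)ᵐᵒᵖ (FrameJet k n))))

/-- The jet of fanning curves spanned by a jet of fanning frames. -/
noncomputable def mk (A : FrameJet k n) : GrJet k n := Quotient.mk _ A

theorem smul_leibniz (T : GL (Fin k × Fin n) ℝ) (X : (JetGL k n)ᵐᵒᵖ) (A : FrameJet k n) :
    T • X • A = X • T • A := FrameJet.ext_juxtapose (by
  change juxtapose (fun i => T.1 * leibniz (derivs A) X.unop.1 i) =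
    juxtapose (leibniz (fun i => T.1 * derivs A i) X.unop.1)
  simp only [juxtapose_leibniz, juxtapose_left_mul, Matrix.mul_assoc])

/-- The action of `GL(kn)` on jets of fanning curves induced by its action on frames. -/
noncomputable instance : MulAction (GL (Fin k × Fin n) ℝ) (GrJet k n) where
  smul T := Quotient.map (T • ·) (by
    rintro A B ⟨X, rfl⟩
    exact ⟨X, (smul_leibniz T X B).symm⟩)
  one_smul s := Quotient.inductionOn s fun A => congrArg mk (one_smul _ A)
  mul_smul T S s := Quotient.inductionOn s fun A => congrArg mk (mul_smul T S A)

/-- The fundamental endomorphism, as a map from jets of fanning curves to `gl(kn)`. -/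
noncomputable def fundEnd : GrJet k n → Matrix (Fin k × Fin n) (Fin k × Fin n) ℝ :=
  Quotient.lift (frameEnd : FrameJet k n → _) (by
    rintro A B ⟨X, rfl⟩
    have hu := (Matrix.isUnit_iff_isUnit_det _).1 ((isUnit_toeplitz X.unop.1).2 X.unop.2)
    change juxtapose (leibniz (derivs B) X.unop.1) * nilp k n *
      (juxtapose (leibniz (derivs B) X.unop.1))⁻¹ =
      juxtapose (derivs B) * nilp k n * (juxtapose (derivs B))⁻¹
    rw [juxtapose_leibniz, Matrix.mul_inv_rev, Matrix.mul_assoc (juxtapose (derivs B)), toeplitz_comm]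
    simp only [Matrix.mul_assoc]
    rw [← Matrix.mul_assoc (toeplitz _), Matrix.mul_nonsing_inv _ hu, Matrix.one_mul])

end GrJet

section Smoothness

variable {E : Type*} [NormedAddCommGroup E] [NormedSpace ℝ E] {s : Set E}

theorem contDiffOn_mul_entry {l m p : Type} [Fintype m] {f : E → Matrix l m ℝ} {g : E → Matrix m p ℝ}
    (hf : ∀ i j, ContDiffOn ℝ ∞ (fun x => f x i j) s)
    (hg : ∀ i j, ContDiffOn ℝ ∞ (fun x => g x i j) s) (i : l) (j : p) :
    ContDiffOn ℝ ∞ (fun x => (f x * g x) i j) s := by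
  simp only [Matrix.mul_apply]
  exact ContDiffOn.sum fun q _ => (hf i q).mul (hg q j)

theorem contDiffOn_det {l : Type} [Fintype l] [DecidableEq l] {f : E → Matrix l l ℝ}
    (hf : ∀ i j, ContDiffOn ℝ ∞ (fun x => f x i j) s) :
    ContDiffOn ℝ ∞ (fun x => (f x).det) s := by
  simp only [Matrix.det_apply']
  exact ContDiffOn.sum fun σ _ => contDiffOn_const.mul
    (contDiffOn_prod fun i _ => hf (σ i) i)

theorem contDiffOn_inv_entry {l : Type} [Fintype l] [DecidableEq l] {f : E → Matrix l l ℝ}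
    (hf : ∀ i j, ContDiffOn ℝ ∞ (fun x => f x i j) s)
    (hu : ∀ x ∈ s, IsUnit (f x)) (i j : l) :
    ContDiffOn ℝ ∞ (fun x => (f x)⁻¹ i j) s := by
  simp only [Matrix.inv_def, Matrix.smul_apply, Ring.inverse_eq_inv', smul_eq_mul,
    Matrix.adjugate_apply]
  refine ((contDiffOn_det hf).inv fun x hx => ?_).mul (contDiffOn_det fun a b => ?_)
  · exact isUnit_iff_ne_zero.1 ((Matrix.isUnit_iff_isUnit_det _).1 (hu x hx))
  · simp only [Matrix.updateRow_apply]
    split_ifs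
    · exact contDiffOn_const
    · exact hf a b

end Smoothness

open Classical in
/-- The jet of fanning frames whose juxtaposed matrix is a given invertible matrix (and an arbitrary
value if the matrix is not invertible). -/
noncomputable def frameOf {k n : ℕ} (M : Matrix (Fin k × Fin n) (Fin k × Fin n) ℝ) : FrameJet k n :=
  if h : IsUnit M then ofDerivs (fun i => Matrix.of fun p b => M p (i, b)) h
  else ofDerivs (fun i => Matrix.of fun p b =>
    (1 : Matrix (Fin k × Fin n) (Fin k × Fin n) ℝ) p (i, b)) isUnit_one

theorem juxtapose_frameOf {k n : ℕ} {M : Matrix (Fin k × Fin n) (Fin k × Fin n) ℝ} (h : IsUnit M) :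
    juxtapose (derivs (frameOf M)) = M := by
  rw [frameOf, dif_pos h]
  rfl

theorem continuousOn_frameOf {k n : ℕ} :
    ContinuousOn (frameOf : Matrix (Fin k × Fin n) (Fin k × Fin n) ℝ → _) {M | IsUnit M} := by
  have hi : Topology.IsInducing fun A : FrameJet k n => A.1 := Topology.IsInducing.subtypeVal
  rw [hi.continuousOn_iff]
  have h : Continuous (fun (M : Matrix (Fin k × Fin n) (Fin k × Fin n) ℝ) (i : Fin k)
      (p : Fin k × Fin n) (b : Fin n) => M p (i, b)) :=
    continuous_pi fun i => continuous_pi fun p => continuous_pi fun b =>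
      continuous_apply_apply p (i, b)
  refine h.continuousOn.congr fun M hM => ?_
  simp only [Function.comp, frameOf, dif_pos (show IsUnit M from hM)]
  rfl

/-- The model space of the charts of the space of jets of fanning curves: all block rows but the
first of a `kn × kn` matrix. -/
abbrev SliceModel (k n : ℕ) [NeZero k] : Type :=
  {i : Fin k // i ≠ 0} × Fin n → Fin k × Fin n → ℝ

section Charts

variable {k n : ℕ} [NeZero k]

/-- All block rows but the first. -/
def lower (M : Matrix (Fin k × Fin n) (Fin k × Fin n) ℝ) : SliceModel k n :=
  fun p q => M (p.1.1, p.2) q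

/-- The matrix with first block row `(I | 0 | ⋯ | 0)` and remaining block rows `y`. -/
def slice (y : SliceModel k n) : Matrix (Fin k × Fin n) (Fin k × Fin n) ℝ :=
  Matrix.of fun p q => if h : p.1 = 0 then (1 : Matrix (Fin k × Fin n) (Fin k × Fin n) ℝ) p q
    else y (⟨p.1, h⟩, p.2) q

/-- Right multiplication of (the jet of frames with juxtaposed matrix) `M` by the inverse of the jet
given by its first block row, which makes the first block row equal to `(I | 0 | ⋯ | 0)`. -/
noncomputable def normalize (M : Matrix (Fin k × Fin n) (Fin k × Fin n) ℝ) :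
    Matrix (Fin k × Fin n) (Fin k × Fin n) ℝ :=
  M * (toeplitz (row M))⁻¹

theorem lower_slice (y : SliceModel k n) : lower (slice y) = y := by
  ext ⟨⟨i, hi⟩, a⟩ q
  simp [lower, slice, hi]

theorem row_slice (y : SliceModel k n) : row (slice y) = row 1 := by
  ext i a b
  simp [row, slice]

theorem slice_lower {M : Matrix (Fin k × Fin n) (Fin k × Fin n) ℝ} (h : row M = row 1) :
    slice (lower M) = M := by
  ext ⟨i, a⟩ ⟨j, b⟩
  by_cases hi : i = 0
  · subst hi
    have := congrFun (congrFun (congrFun h j) a) b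
    simp only [row, Matrix.of_apply] at this
    simp [slice, this]
  · simp [slice, lower, hi]

theorem toeplitz_row_one :
    toeplitz (row (1 : Matrix (Fin k × Fin n) (Fin k × Fin n) ℝ)) = 1 :=
  toeplitz_row_of_comm (by simp)

theorem isUnit_row_one :
    IsUnit (row (1 : Matrix (Fin k × Fin n) (Fin k × Fin n) ℝ) 0) := by
  rw [← isUnit_toeplitz, toeplitz_row_one]
  exact isUnit_one

theorem row_normalize {M : Matrix (Fin k × Fin n) (Fin k × Fin n) ℝ} (h : IsUnit (row M 0)) :
    row (normalize M) = row 1 := by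
  let X : JetGL k n := ⟨row M, h⟩
  have hu := (Matrix.isUnit_iff_isUnit_det _).1 ((isUnit_toeplitz _).2 h)
  have h2 : row (normalize M) = leibniz (row M) (row (toeplitz (row M))⁻¹) := by
    rw [← row_mul_toeplitz, JetGL.toeplitz_inv X, normalize]
  rw [h2, ← row_toeplitz (leibniz _ _), toeplitz_leibniz, JetGL.toeplitz_inv X,
    Matrix.mul_nonsing_inv _ hu]

theorem normalize_slice (y : SliceModel k n) : normalize (slice y) = slice y := by
  rw [normalize, row_slice, toeplitz_row_one, inv_one, mul_one]

theorem normalize_mul_toeplitz (M : Matrix (Fin k × Fin n) (Fin k × Fin n) ℝ)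
    (X : JetGL k n) : normalize (M * toeplitz X.1) = normalize M := by
  have hu := (Matrix.isUnit_iff_isUnit_det _).1 ((isUnit_toeplitz _).2 X.2)
  rw [normalize, row_mul_toeplitz, toeplitz_leibniz, Matrix.mul_inv_rev, Matrix.mul_assoc,
    ← Matrix.mul_assoc (toeplitz X.1), Matrix.mul_nonsing_inv _ hu, Matrix.one_mul, normalize]

theorem isUnit_row_mul_toeplitz (M : Matrix (Fin k × Fin n) (Fin k × Fin n) ℝ)
    (X : JetGL k n) : IsUnit (row (M * toeplitz X.1) 0) ↔ IsUnit (row M 0) := by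
  have hX := (isUnit_toeplitz _).2 X.2
  rw [← isUnit_toeplitz, ← isUnit_toeplitz, row_mul_toeplitz, toeplitz_leibniz,
    Matrix.isUnit_iff_isUnit_det, Matrix.isUnit_iff_isUnit_det, Matrix.det_mul, IsUnit.mul_iff]
  exact and_iff_left ((Matrix.isUnit_iff_isUnit_det _).1 hX)

theorem isUnit_normalize {M : Matrix (Fin k × Fin n) (Fin k × Fin n) ℝ} (hM : IsUnit M)
    (h : IsUnit (row M 0)) : IsUnit (normalize M) :=
  hM.mul (Matrix.isUnit_nonsing_inv_iff.2 ((isUnit_toeplitz _).2 h))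

theorem contDiffOn_lower_normalize {E : Type*} [NormedAddCommGroup E] [NormedSpace ℝ E]
    {s : Set E} {f : E → Matrix (Fin k × Fin n) (Fin k × Fin n) ℝ}
    (hf : ∀ p q, ContDiffOn ℝ ∞ (fun x => f x p q) s)
    (hu : ∀ x ∈ s, IsUnit (row (f x) 0)) :
    ContDiffOn ℝ ∞ (fun x => lower (normalize (f x))) s :=
  contDiffOn_pi.2 fun _ => contDiffOn_pi.2 fun q => contDiffOn_mul_entry hf
    (contDiffOn_inv_entry (f := fun x => toeplitz (row (f x)))
      (fun _ _ => contDiffOn_const.mul (hf _ _)) fun x hx => (isUnit_toeplitz _).2 (hu x hx)) _ q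

theorem contDiff_slice (p q : Fin k × Fin n) :
    ContDiff ℝ ∞ fun y : SliceModel k n => slice y p q := by
  simp only [slice, Matrix.of_apply]
  split_ifs
  · exact contDiff_const
  · exact contDiff_apply_apply ℝ ℝ _ _

theorem continuous_slice : Continuous (slice : SliceModel k n → _) :=
  continuous_matrix fun p q => (contDiff_slice p q).continuous

theorem isOpen_isUnit_row :
    IsOpen {M : Matrix (Fin k × Fin n) (Fin k × Fin n) ℝ | IsUnit (row M 0)} :=
  (isOpen_isUnit (Fin n)).preimage (continuous_matrix fun a b => 
    continuous_apply_apply ((0 : Fin k), a) ((0 : Fin k), b))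

namespace GrJet

theorem mk_eq_mk {A B : FrameJet k n} (X : JetGL k n)
    (h : juxtapose (derivs A) = juxtapose (derivs B) * toeplitz X.1) : mk A = mk B :=
  Quotient.sound ⟨MulOpposite.op X, FrameJet.ext_juxtapose
    ((juxtapose_leibniz (derivs B) X.1).trans h.symm)⟩

theorem isQuotientMap_mk : Topology.IsQuotientMap (mk : FrameJet k n → GrJet k n) :=
  isQuotientMap_quotient_mk'

/-- The jets spanned by a jet of frames `A` such that the first block of `g⁻¹ A` is invertible. -/
def chartSource (g : GL (Fin k × Fin n) ℝ) : Set (GrJet k n) :=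
  {s | Quotient.liftOn s (fun A : FrameJet k n => IsUnit (row (g⁻¹.1 * juxtapose (derivs A)) 0)) (by
    rintro A B ⟨X, rfl⟩
    change IsUnit (row (g⁻¹.1 * juxtapose (leibniz (derivs B) X.unop.1)) 0) = _
    rw [juxtapose_leibniz, ← Matrix.mul_assoc, isUnit_row_mul_toeplitz])}

/-- The coordinates of a jet of fanning curves: represent it by the unique jet of frames `A` such that
`g⁻¹ A` has first block row `(I | 0 | ⋯ | 0)`, and take the other block rows of `g⁻¹ A`. -/
noncomputable def chartFun (g : GL (Fin k × Fin n) ℝ) : GrJet k n → SliceModel k n :=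
  Quotient.lift (fun A : FrameJet k n => lower (normalize (g⁻¹.1 * juxtapose (derivs A)))) (by
    rintro A B ⟨X, rfl⟩
    change lower (normalize (g⁻¹.1 * juxtapose (leibniz (derivs B) X.unop.1))) = _
    rw [juxtapose_leibniz, ← Matrix.mul_assoc, normalize_mul_toeplitz])

theorem isOpen_chartSource (g : GL (Fin k × Fin n) ℝ) : IsOpen (chartSource g) := by
  rw [← isQuotientMap_mk.isOpen_preimage]
  exact isOpen_isUnit_row.preimage
    (continuous_const.matrix_mul (continuous_derivs))

/-- The charts of the space of jets of fanning curves, one for each `g` in `GL(kn)`. -/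
noncomputable def chart (g : GL (Fin k × Fin n) ℝ) :
    OpenPartialHomeomorph (GrJet k n) (SliceModel k n) where
  toFun := chartFun g
  invFun y := mk (frameOf (g.1 * slice y))
  source := chartSource g
  target := {y | IsUnit (slice y)}
  map_source' s := Quotient.inductionOn s fun A (hA : IsUnit _) => by
    change IsUnit (slice (lower (normalize (g⁻¹.1 * juxtapose (derivs A)))))
    rw [slice_lower (row_normalize hA)]
    exact isUnit_normalize (g⁻¹.isUnit.mul (isUnit_derivs A)) hA
  map_target' y hy := by
    change IsUnit (row (g⁻¹.1 * juxtapose (derivs (frameOf (g.1 * slice y)))) 0)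
    rw [juxtapose_frameOf (g.isUnit.mul hy), ← Matrix.mul_assoc, Units.inv_mul, Matrix.one_mul,
      row_slice]
    exact isUnit_row_one
  left_inv' s := Quotient.inductionOn s fun A (hA : IsUnit _) => by
    change mk (frameOf (g.1 * slice (lower (normalize (g⁻¹.1 * juxtapose (derivs A)))))) = mk A
    refine mk_eq_mk (⟨_, hA⟩ : JetGL k n)⁻¹ ?_
    rw [slice_lower (row_normalize hA),
      juxtapose_frameOf (g.isUnit.mul (isUnit_normalize (g⁻¹.isUnit.mul (isUnit_derivs A)) hA)), normalize,
      ← Matrix.mul_assoc, ← Matrix.mul_assoc, Units.mul_inv, Matrix.one_mul]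
    congr 1
    exact (JetGL.toeplitz_inv (⟨_, hA⟩ : JetGL k n)).symm
  right_inv' y hy := by
    change lower (normalize (g⁻¹.1 * juxtapose (derivs (frameOf (g.1 * slice y))))) = y
    rw [juxtapose_frameOf (g.isUnit.mul hy), ← Matrix.mul_assoc, Units.inv_mul, Matrix.one_mul,
      normalize_slice, lower_slice]
  open_source := isOpen_chartSource g
  open_target := (isOpen_isUnit _).preimage continuous_slice
  continuousOn_toFun := by
    rw [isQuotientMap_mk.continuousOn_isOpen_iff (isOpen_chartSource g)]
    have h := (contDiffOn_lower_normalize (k := k) (n := n)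
      (E := Fin k × Fin n → Fin k × Fin n → ℝ) (f := fun M => Matrix.of M)
      (s := {M | IsUnit (row (Matrix.of M) 0)})
      (fun p q => (contDiff_apply_apply ℝ ℝ p q).contDiffOn) fun x hx => hx).continuousOn
    have hc : Continuous fun A : FrameJet k n => g⁻¹.1 * juxtapose (derivs A) :=
      continuous_const.matrix_mul (continuous_derivs)
    exact h.comp hc.continuousOn fun A hA => hA
  continuousOn_invFun := by
    have hc : Continuous fun y : SliceModel k n => g.1 * slice y :=
      continuous_const.matrix_mul continuous_slice
    exact isQuotientMap_mk.continuous.comp_continuousOn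
      (continuousOn_frameOf.comp hc.continuousOn fun y hy => g.isUnit.mul hy)

theorem exists_mem_chartSource (s : GrJet k n) : ∃ g, s ∈ (chart g).source :=
  Quotient.inductionOn s fun A => by
    obtain ⟨g, hg⟩ := isUnit_derivs A
    refine ⟨g, ?_⟩
    change IsUnit (row (g⁻¹.1 * juxtapose (derivs A)) 0)
    rw [← hg, Units.inv_mul]
    exact isUnit_row_one

/-- The quotient smooth structure on the space of jets of fanning curves. -/
noncomputable instance : ChartedSpace (SliceModel k n) (GrJet k n) where
  atlas := Set.range chart
  chartAt s := chart (exists_mem_chartSource s).choose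
  mem_chart_source s := (exists_mem_chartSource s).choose_spec
  chart_mem_atlas _ := ⟨_, rfl⟩

instance : IsManifold 𝓘(ℝ, SliceModel k n) ∞ (GrJet k n) := by
  refine isManifold_of_contDiffOn _ _ _ ?_
  rintro _ _ ⟨g, rfl⟩ ⟨h, rfl⟩
  have key : ∀ y ∈ ((chart g).symm ≫ₕ chart h).source,
      juxtapose (derivs (frameOf (g.1 * slice y))) = g.1 * slice y ∧
        IsUnit (row (h⁻¹.1 * (g.1 * slice y)) 0) := by
    rintro y ⟨hy, hy'⟩
    have h1 := juxtapose_frameOf (g.isUnit.mul (show IsUnit (slice y) from hy))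
    refine ⟨h1, ?_⟩
    rw [← h1]
    exact hy'
  have hs : ∀ p q, ContDiffOn ℝ ∞ (fun y : SliceModel k n => (h⁻¹.1 * (g.1 * slice y)) p q)
      ((chart g).symm ≫ₕ chart h).source :=
    contDiffOn_mul_entry (fun _ _ => contDiffOn_const)
      (contDiffOn_mul_entry (fun _ _ => contDiffOn_const) fun p q => (contDiff_slice p q).contDiffOn)
  have := (contDiffOn_lower_normalize hs fun y hy => (key y hy).2).congr
    (f₁ := (chart g).symm ≫ₕ chart h) fun y hy => by
      change lower (normalize (h⁻¹.1 * juxtapose (derivs (frameOf (g.1 * slice y))))) = _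
      rw [(key y hy).1]
  simpa using this

end GrJet

end Charts

end FanningJets

open FanningJets

/-! Write `M` for the juxtaposed matrix of a jet of frames and `N` for `nilp k n`. The fundamental
endomorphism is `M N M⁻¹`, and changing the representative multiplies `M` on the right by a block
Toeplitz matrix, which commutes with `N`. Fix `g` in `GL(kn)`. Where the first block of `g⁻¹ M` is
invertible, there is a unique representative `M = g P` such that `P` has first block row `(I | 0 | ⋯
| 0)`; the other rows of `P` are the chart coordinates of the jet.

The point is that `P` can be read off from `Z = P N P⁻¹`. The matrix `B = P⁻¹` has the same first
block row and satisfies `N B = B Z`. Row by row this says `(i+1) B_{i+1} = B_i Z`, so `B_i = B_0 Zⁱ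
/ i!`. Thus `B = obs Z` is polynomial in `Z`, and inverting it recovers the jet smoothly (`eq_obs`,
`inv_obs_conj_nilp`).

For an arbitrary `Z` with `obs Z` invertible, the recursion still holds by construction except in
the last block row, where nothing follows `B_{k-1}`. Hence `Z = P (N + W) P⁻¹` with `P = (obs Z)⁻¹`
and `W` supported in the last block row: a block companion form. The pair `(P, W)` gives local
coordinates on `gl(kn)` in which the fundamental endomorphism is `P ↦ (P, 0)` (`endCoord_fundEnd`),
so it is an immersion. Invertibility of `obs` also decides which chart domain a jet lies in
(`isUnit_obs_fundEnd`), which turns the local inverse into global injectivity and an embedding.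

The remaining claims are formal. Every invertible matrix is the juxtaposition of some frame, so the
image is the orbit of `N`; equivariance and injectivity give equal isotropy groups. The quotient map
is a submersion because `M = g P toeplitz X` splits frames locally into the coordinates `(P, X)`. -/

namespace FanningJets

variable {k n : ℕ} [NeZero k]

/-! ### Recovering a normalized frame from its endomorphism -/

/-- The matrix whose `i`-th block row is the first block row of `Zⁱ / i!`. -/
noncomputable def obs (Z : Matrix (Fin k × Fin n) (Fin k × Fin n) ℝ) :
    Matrix (Fin k × Fin n) (Fin k × Fin n) ℝ :=
  Matrix.of fun p q => (p.1.1.factorial : ℝ)⁻¹ * (Z ^ p.1.1) (0, p.2) q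

/-- The block rows of `B` obey `(i+1) B_{i+1} = B_i Z`, and the first one is prescribed, so
induction on the row index determines them all. The last block row of `N B = B Z` is deliberately
not assumed, so that the lemma also applies to `N` perturbed in its last block row. -/
theorem eq_obs {B Z : Matrix (Fin k × Fin n) (Fin k × Fin n) ℝ}
    (h0 : ∀ a q, B (0, a) q = (1 : Matrix (Fin k × Fin n) (Fin k × Fin n) ℝ) (0, a) q)
    (h : ∀ (i : Fin k) a q, i.1 + 1 < k → (nilp k n * B) (i, a) q = (B * Z) (i, a) q) :
    B = obs Z := by
  have key : ∀ (i : ℕ) (hi : i < k) a q, B (⟨i, hi⟩, a) q = obs Z (⟨i, hi⟩, a) q := by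
    intro i
    induction i with
    | zero =>
      intro hi a q
      have e : (⟨0, hi⟩ : Fin k) = 0 := by ext; simp
      simp [e, obs, h0]
    | succ i ih =>
      intro hi a q
      have hpos : (i + 1 : ℝ) ≠ 0 := by positivity
      apply mul_left_cancel₀ hpos
      rw [← nilp_mul _ i hi, h ⟨i, by omega⟩ a q hi, Matrix.mul_apply]
      simp only [ih, obs, Matrix.of_apply, pow_succ, Matrix.mul_apply, Nat.factorial_succ,
        Finset.mul_sum]
      refine Finset.sum_congr rfl fun j _ => ?_
      push_cast
      field_simp
  ext ⟨⟨i, hi⟩, a⟩ q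
  exact key i hi a q

theorem mul_apply_zero_of_row {P : Matrix (Fin k × Fin n) (Fin k × Fin n) ℝ}
    {Q : Matrix (Fin k × Fin n) (Fin k × Fin n) ℝ} (h : row P = row Q)
    (B : Matrix (Fin k × Fin n) (Fin k × Fin n) ℝ) (a : Fin n) (q : Fin k × Fin n) :
    (P * B) (0, a) q = (Q * B) (0, a) q := by
  simp only [Matrix.mul_apply]
  refine Finset.sum_congr rfl fun p _ => ?_
  have := congrFun (congrFun (congrFun h p.1) a) p.2
  simp only [row, Matrix.of_apply] at this
  rw [this]

/-- The matrix with last block row `w` and all other block rows zero. -/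
def lastRow (w : Fin n → Fin k × Fin n → ℝ) : Matrix (Fin k × Fin n) (Fin k × Fin n) ℝ :=
  Matrix.of fun p q => if p.1.1 + 1 = k then w p.2 q else 0

/-- The last block row of a matrix. -/
def last (M : Matrix (Fin k × Fin n) (Fin k × Fin n) ℝ) : Fin n → Fin k × Fin n → ℝ :=
  fun a q => M (⟨k - 1, Nat.sub_lt (NeZero.pos k) one_pos⟩, a) q

theorem last_lastRow (w : Fin n → Fin k × Fin n → ℝ) : last (lastRow w) = w := by
  have := NeZero.pos k
  ext a q
  simp only [last, lastRow, Matrix.of_apply]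
  rw [if_pos (by omega)]

theorem lastRow_last {M : Matrix (Fin k × Fin n) (Fin k × Fin n) ℝ}
    (h : ∀ (i : Fin k) a q, i.1 + 1 < k → M (i, a) q = 0) : lastRow (last M) = M := by
  ext ⟨i, a⟩ q
  simp only [last, lastRow, Matrix.of_apply]
  split_ifs with hi
  · have e : (⟨k - 1, Nat.sub_lt (NeZero.pos k) one_pos⟩ : Fin k) = i := by
      ext; simp only; omega
    rw [e]
  · exact (h i a q (by omega)).symm

/-- Converse of the recursion in `eq_obs`: `(i+1) Zⁱ⁺¹ / (i+1)! = (Zⁱ / i!) Z`. In the last block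
row the left side is zero and the identity fails in general; `defect` measures this failure. -/
theorem nilp_mul_obs (Z : Matrix (Fin k × Fin n) (Fin k × Fin n) ℝ) (i : Fin k) (a : Fin n)
    (q : Fin k × Fin n) (hi : i.1 + 1 < k) : (nilp k n * obs Z) (i, a) q = (obs Z * Z) (i, a) q := by
  obtain ⟨i, hik⟩ := i
  rw [nilp_mul _ i hi, Matrix.mul_apply]
  simp only [obs, Matrix.of_apply, pow_succ, Matrix.mul_apply, Nat.factorial_succ,
    Finset.mul_sum]
  refine Finset.sum_congr rfl fun j _ => ?_
  push_cast
  field_simp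

theorem row_obs (Z : Matrix (Fin k × Fin n) (Fin k × Fin n) ℝ) : row (obs Z) = row 1 := by
  ext i a b
  simp [row, obs]

/-- The first block row of `P P⁻¹ = 1` involves only the first block row of `P`, which acts like
that of the identity. -/
theorem row_inv {P : Matrix (Fin k × Fin n) (Fin k × Fin n) ℝ} (hu : IsUnit P)
    (h : row P = row 1) : row P⁻¹ = row 1 := by
  ext i a b
  have := mul_apply_zero_of_row h P⁻¹ a (i, b)
  rw [Matrix.mul_nonsing_inv _ ((Matrix.isUnit_iff_isUnit_det _).1 hu), Matrix.one_mul] at this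
  exact this.symm

/-- The right side intertwines `N` with `M N M⁻¹` because `toeplitz (row M)` commutes with `N`; its
first block row is that of `M M⁻¹ = 1`. So `eq_obs` identifies it. -/
theorem obs_conj_nilp {M : Matrix (Fin k × Fin n) (Fin k × Fin n) ℝ} (hM : IsUnit M) :
    obs (M * nilp k n * M⁻¹) = toeplitz (row M) * M⁻¹ := by
  have hu := (Matrix.isUnit_iff_isUnit_det _).1 hM
  refine (eq_obs (fun a q => ?_) fun i a q _ => ?_).symm
  · rw [mul_apply_zero_of_row (row_toeplitz (row M)), Matrix.mul_nonsing_inv _ hu]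
  · rw [← Matrix.mul_assoc, ← toeplitz_comm]
    simp only [Matrix.mul_assoc]
    rw [← Matrix.mul_assoc M⁻¹, Matrix.nonsing_inv_mul _ hu, Matrix.one_mul]

theorem obs_conj_slice {P : Matrix (Fin k × Fin n) (Fin k × Fin n) ℝ} (hP : IsUnit P)
    (h : row P = row 1) (w : Fin n → Fin k × Fin n → ℝ) :
    obs (P * (nilp k n + lastRow w) * P⁻¹) = P⁻¹ := by
  have hu := (Matrix.isUnit_iff_isUnit_det _).1 hP
  refine (eq_obs (fun a q => ?_) fun i a q hi => ?_).symm
  · exact congrFun (congrFun (congrFun (row_inv hP h) q.1) a) q.2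
  · simp only [← Matrix.mul_assoc]
    rw [Matrix.nonsing_inv_mul _ hu, Matrix.one_mul, Matrix.add_mul, Matrix.add_apply,
      left_eq_add, Matrix.mul_apply]
    -- What is left is row `i` of `lastRow w * P⁻¹`, which vanishes since `i` is not the last block.
    refine Finset.sum_eq_zero fun p _ => ?_
    simp [lastRow, hi.ne]

/-! ### Companion form: splitting off a last block row -/

/-- The defect of `Z` from being conjugate to `nilp` by the inverse of `obs Z`. -/
noncomputable def defect (Z : Matrix (Fin k × Fin n) (Fin k × Fin n) ℝ) :
    Matrix (Fin k × Fin n) (Fin k × Fin n) ℝ :=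
  (obs Z * Z - nilp k n * obs Z) * (obs Z)⁻¹

theorem lastRow_last_defect (Z : Matrix (Fin k × Fin n) (Fin k × Fin n) ℝ) :
    lastRow (last (defect Z)) = defect Z := by
  refine lastRow_last fun i a q hi => ?_
  rw [defect, Matrix.mul_apply]
  refine Finset.sum_eq_zero fun p _ => ?_
  rw [Matrix.sub_apply, nilp_mul_obs Z i a p hi, sub_self, zero_mul]

theorem conj_defect {Z : Matrix (Fin k × Fin n) (Fin k × Fin n) ℝ} (h : IsUnit (obs Z)) :
    (obs Z)⁻¹ * (nilp k n + defect Z) * obs Z = Z := by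
  have hu := (Matrix.isUnit_iff_isUnit_det _).1 h
  rw [Matrix.mul_assoc, Matrix.add_mul, defect, Matrix.mul_assoc _ (obs Z)⁻¹,
    Matrix.nonsing_inv_mul _ hu, Matrix.mul_one, add_sub_cancel, ← Matrix.mul_assoc,
    Matrix.nonsing_inv_mul _ hu, Matrix.one_mul]

theorem defect_conj {P : Matrix (Fin k × Fin n) (Fin k × Fin n) ℝ} (hP : IsUnit P)
    (h : row P = row 1) (w : Fin n → Fin k × Fin n → ℝ) :
    defect (P * (nilp k n + lastRow w) * P⁻¹) = lastRow w := by
  have hu := (Matrix.isUnit_iff_isUnit_det _).1 hP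
  rw [defect, obs_conj_slice hP h, Matrix.nonsing_inv_nonsing_inv _ hu]
  simp only [← Matrix.mul_assoc]
  rw [Matrix.nonsing_inv_mul _ hu, Matrix.one_mul, ← Matrix.sub_mul, add_sub_cancel_left,
    Matrix.mul_assoc, Matrix.nonsing_inv_mul _ hu, Matrix.mul_one]

theorem defect_conj_nilp {M : Matrix (Fin k × Fin n) (Fin k × Fin n) ℝ} (hM : IsUnit M) :
    defect (M * nilp k n * M⁻¹) = 0 := by
  have hu := (Matrix.isUnit_iff_isUnit_det _).1 hM
  rw [defect, obs_conj_nilp hM, ← Matrix.mul_assoc (nilp k n), ← toeplitz_comm]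
  simp only [Matrix.mul_assoc]
  rw [← Matrix.mul_assoc M⁻¹ M, Matrix.nonsing_inv_mul _ hu, Matrix.one_mul, sub_self,
    Matrix.zero_mul]

/-- Inverting `obs` returns the normalized representative of the jet. No invertibility of the first
block is needed: if it is singular, the inverse of `toeplitz (row M)` is zero by convention and both
sides vanish. -/
theorem inv_obs_conj_nilp {M : Matrix (Fin k × Fin n) (Fin k × Fin n) ℝ} (hM : IsUnit M) :
    (obs (M * nilp k n * M⁻¹))⁻¹ = normalize M := by
  rw [obs_conj_nilp hM, Matrix.mul_inv_rev,
    Matrix.nonsing_inv_nonsing_inv _ ((Matrix.isUnit_iff_isUnit_det _).1 hM), normalize]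

theorem isUnit_obs_conj_nilp {M : Matrix (Fin k × Fin n) (Fin k × Fin n) ℝ} (hM : IsUnit M) :
    IsUnit (obs (M * nilp k n * M⁻¹)) ↔ IsUnit (row M 0) := by
  rw [obs_conj_nilp hM, ← isUnit_toeplitz, Matrix.isUnit_iff_isUnit_det, Matrix.det_mul,
    IsUnit.mul_iff, ← Matrix.isUnit_iff_isUnit_det, ← Matrix.isUnit_iff_isUnit_det,
    Matrix.isUnit_nonsing_inv_iff]
  exact and_iff_left hM

/-! ### Smooth dependence of `obs` and `defect` -/

section Smoothness

variable {E : Type*} [NormedAddCommGroup E] [NormedSpace ℝ E] {s : Set E}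

theorem contDiffOn_pow_entry {l : Type} [Fintype l] [DecidableEq l] {f : E → Matrix l l ℝ}
    (hf : ∀ i j, ContDiffOn ℝ ∞ (fun x => f x i j) s) (m : ℕ) (i j : l) :
    ContDiffOn ℝ ∞ (fun x => (f x ^ m) i j) s := by
  induction m generalizing i j with
  | zero => simpa using contDiffOn_const
  | succ m ih =>
    simp only [pow_succ]
    exact contDiffOn_mul_entry ih hf i j

theorem contDiffOn_obs {f : E → Matrix (Fin k × Fin n) (Fin k × Fin n) ℝ}
    (hf : ∀ i j, ContDiffOn ℝ ∞ (fun x => f x i j) s) (p q : Fin k × Fin n) :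
    ContDiffOn ℝ ∞ (fun x => obs (f x) p q) s :=
  contDiffOn_const.mul (contDiffOn_pow_entry hf _ _ _)

theorem contDiffOn_defect {f : E → Matrix (Fin k × Fin n) (Fin k × Fin n) ℝ}
    (hf : ∀ i j, ContDiffOn ℝ ∞ (fun x => f x i j) s) (hu : ∀ x ∈ s, IsUnit (obs (f x)))
    (p q : Fin k × Fin n) : ContDiffOn ℝ ∞ (fun x => defect (f x) p q) s :=
  contDiffOn_mul_entry (f := fun x => obs (f x) * f x - nilp k n * obs (f x))
    (g := fun x => (obs (f x))⁻¹)
    (fun i j => (contDiffOn_mul_entry (f := fun x => obs (f x)) (contDiffOn_obs hf) hf i j).sub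
      (contDiffOn_mul_entry (f := fun _ => nilp k n) (g := fun x => obs (f x))
        (fun _ _ => contDiffOn_const) (contDiffOn_obs hf) i j))
    (contDiffOn_inv_entry (contDiffOn_obs hf) hu) p q

theorem contDiffOn_conj {l : Type} [Fintype l] {f : E → Matrix l l ℝ}
    (hf : ∀ i j, ContDiffOn ℝ ∞ (fun x => f x i j) s) (P Q : Matrix l l ℝ) (p q : l) :
    ContDiffOn ℝ ∞ (fun x => (P * f x * Q) p q) s :=
  contDiffOn_mul_entry (f := fun x => P * f x) (g := fun _ => Q)
    (contDiffOn_mul_entry (f := fun _ => P) (fun _ _ => contDiffOn_const) hf)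
    (fun _ _ => contDiffOn_const) p q

end Smoothness

theorem continuous_obs :
    Continuous (obs : Matrix (Fin k × Fin n) (Fin k × Fin n) ℝ → _) :=
  continuous_matrix fun p q => continuous_const.mul
    (continuous_apply_apply ((0 : Fin k), p.2) q |>.comp (continuous_pow p.1.1))

/-! ### Model spaces and dimension counts -/

/-- Matrices of size `kn × kn`, given by their entries. -/
abbrev EndModel (k n : ℕ) : Type := Fin k × Fin n → Fin k × Fin n → ℝ

/-- Tuples of `k` matrices of size `kn × n`, given by their entries. -/
abbrev FrameModel (k n : ℕ) : Type := Fin k → Fin k × Fin n → Fin n → ℝ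

theorem finrank_sliceModel :
    Module.finrank ℝ (SliceModel k n) = (k - 1) * n * (k * n) := by
  rw [Module.finrank_pi_fintype]
  simp [Fintype.card_subtype_compl]

theorem sub_one_mul_add (m : ℕ) : (k - 1) * m + m = k * m := by
  obtain ⟨j, rfl⟩ := Nat.exists_eq_succ_of_ne_zero (NeZero.ne k)
  simp [Nat.succ_mul]

/-- A linear identification of `gl(kn)` with the product of the model space of jets of fanning curves
and the space of block rows. -/
noncomputable def endEquiv (k n : ℕ) [NeZero k] :
    (SliceModel k n × (Fin n → Fin k × Fin n → ℝ)) ≃L[ℝ] EndModel k n :=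
  ContinuousLinearEquiv.ofFinrankEq (by
    -- Count: `(k-1)n · kn + n · kn = (kn)²`. Any linear isomorphism will do, since the charts built
    -- from it absorb the choice.
    rw [Module.finrank_prod, finrank_sliceModel]
    simp only [Module.finrank_pi_fintype, Module.finrank_self, Finset.sum_const,
      Finset.card_univ, Fintype.card_prod, Fintype.card_fin, smul_eq_mul, mul_one]
    rw [mul_assoc, sub_one_mul_add, mul_assoc k n])

/-- A linear identification of tuples of `k` matrices of size `kn × n` with the product of the model
space of jets of fanning curves and the space of tuples of `k` square matrices. -/
noncomputable def frameEquiv (k n : ℕ) [NeZero k] :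
    FrameModel k n ≃L[ℝ] (SliceModel k n × (Fin k → Fin n → Fin n → ℝ)) :=
  ContinuousLinearEquiv.ofFinrankEq (by
    -- Count: `(k-1)n · kn + k · n² = k · kn · n`.
    rw [Module.finrank_prod, finrank_sliceModel]
    simp only [Module.finrank_pi_fintype, Module.finrank_self, Finset.sum_const,
      Finset.card_univ, Fintype.card_prod, Fintype.card_fin, smul_eq_mul, mul_one]
    rw [mul_assoc, mul_left_comm k n n, mul_left_comm n k n, mul_assoc (k - 1),
      mul_left_comm n k n, sub_one_mul_add])

/-! ### Coordinates on frames adapted to the quotient map -/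

/-- The juxtaposed matrix of a tuple given by its entries. -/
def assemble {k n : ℕ} (A : FrameModel k n) : Matrix (Fin k × Fin n) (Fin k × Fin n) ℝ :=
  juxtapose fun i => Matrix.of (A i)

/-- The tuple of block columns of a matrix. -/
def columns {k n : ℕ} (M : Matrix (Fin k × Fin n) (Fin k × Fin n) ℝ) : FrameModel k n :=
  fun i p b => M p (i, b)

/-- The tuple of square matrices with given entries. -/
def ofEntries {k n : ℕ} (X : Fin k → Fin n → Fin n → ℝ) : Fin k → Matrix (Fin n) (Fin n) ℝ :=
  fun i => Matrix.of (X i)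

/-- The entries of the first block row of a matrix. -/
def rowEntries (M : Matrix (Fin k × Fin n) (Fin k × Fin n) ℝ) : Fin k → Fin n → Fin n → ℝ :=
  fun i a b => M (0, a) (i, b)

theorem ofEntries_rowEntries (M : Matrix (Fin k × Fin n) (Fin k × Fin n) ℝ) :
    ofEntries (rowEntries M) = row M := rfl

/-- The first block row of `slice y` is that of the identity, so the product has the first block row
of `toeplitz X`. Thus the group coordinate `X` is recovered from the product. -/
theorem row_slice_mul_toeplitz (y : SliceModel k n) (X : Fin k → Matrix (Fin n) (Fin n) ℝ) :
    row (slice y * toeplitz X) = X := by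
  rw [row_mul_toeplitz, row_slice, ← row_toeplitz (leibniz _ _), toeplitz_leibniz,
    toeplitz_row_one, Matrix.one_mul, row_toeplitz]

theorem rowEntries_slice_mul_toeplitz (y : SliceModel k n) (X : Fin k → Fin n → Fin n → ℝ) :
    rowEntries (slice y * toeplitz (ofEntries X)) = X :=
  row_slice_mul_toeplitz y (ofEntries X)

theorem slice_mul_toeplitz {M : Matrix (Fin k × Fin n) (Fin k × Fin n) ℝ}
    (h : IsUnit (row M 0)) : slice (lower (normalize M)) * toeplitz (row M) = M := by
  rw [slice_lower (row_normalize h), normalize, Matrix.mul_assoc, Matrix.nonsing_inv_mul _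
    ((Matrix.isUnit_iff_isUnit_det _).1 ((isUnit_toeplitz _).2 h)), Matrix.mul_one]

theorem continuous_assemble {k n : ℕ} : Continuous (assemble : FrameModel k n → _) :=
  continuous_juxtapose

theorem contDiff_assemble {k n : ℕ} (p q : Fin k × Fin n) :
    ContDiff ℝ ∞ fun A : FrameModel k n => assemble A p q :=
  (contDiff_apply_apply ℝ ℝ p q.2).comp (contDiff_apply ℝ _ q.1)

/-- The jets of frames whose span lies in the domain of the chart given by `g`. -/
def frameSource (g : GL (Fin k × Fin n) ℝ) : Set (FrameModel k n) :=
  {A | IsUnit (assemble A) ∧ IsUnit (row (g⁻¹.1 * assemble A) 0)}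

/-- The coordinates of the span of a tuple of matrices, together with its first block row relative
to `g`. -/
noncomputable def frameCoord (g : GL (Fin k × Fin n) ℝ) (A : FrameModel k n) :
    SliceModel k n × (Fin k → Fin n → Fin n → ℝ) :=
  (lower (normalize (g⁻¹.1 * assemble A)), rowEntries (g⁻¹.1 * assemble A))

/-- The tuple of matrices with given coordinates. -/
noncomputable def frameCoordSymm (g : GL (Fin k × Fin n) ℝ)
    (y : SliceModel k n × (Fin k → Fin n → Fin n → ℝ)) : FrameModel k n :=
  columns (g.1 * (slice y.1 * toeplitz (ofEntries y.2)))

theorem contDiffOn_frameCoord (g : GL (Fin k × Fin n) ℝ) :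
    ContDiffOn ℝ ∞ (frameCoord g) (frameSource g) := by
  have h : ∀ p q, ContDiffOn ℝ ∞ (fun A : FrameModel k n => (g⁻¹.1 * assemble A) p q)
      (frameSource g) :=
    contDiffOn_mul_entry (f := fun _ => g⁻¹.1) (fun _ _ => contDiffOn_const)
      fun p q => (contDiff_assemble p q).contDiffOn
  exact (contDiffOn_lower_normalize h fun A hA => hA.2).prodMk
    (contDiffOn_pi.2 fun i => contDiffOn_pi.2 fun a => contDiffOn_pi.2 fun b => h (0, a) (i, b))

theorem contDiff_frameCoordSymm (g : GL (Fin k × Fin n) ℝ) :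
    ContDiff ℝ ∞ (frameCoordSymm g) := by
  rw [← contDiffOn_univ]
  refine contDiffOn_pi.2 fun i => contDiffOn_pi.2 fun p => contDiffOn_pi.2 fun b => ?_
  refine contDiffOn_mul_entry (f := fun _ => g.1) (fun _ _ => contDiffOn_const)
    (contDiffOn_mul_entry (f := fun y : SliceModel k n × (Fin k → Fin n → Fin n → ℝ) => slice y.1)
      (g := fun y => toeplitz (ofEntries y.2)) (fun p q => ?_) fun p q => ?_) p (i, b)
  · exact ((contDiff_slice p q).comp contDiff_fst).contDiffOn
  · exact contDiffOn_const.mul (((contDiff_apply_apply ℝ ℝ p.2 q.2).comp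
      (contDiff_apply ℝ (Fin n → Fin n → ℝ) _)).comp contDiff_snd).contDiffOn

/-- Coordinates on tuples of matrices in which taking the span becomes a projection. -/
noncomputable def frameModelChart (g : GL (Fin k × Fin n) ℝ) :
    OpenPartialHomeomorph (FrameModel k n) (SliceModel k n × (Fin k → Fin n → Fin n → ℝ)) where
  toFun := frameCoord g
  invFun := frameCoordSymm g
  source := frameSource g
  target := {y | IsUnit (slice y.1) ∧ IsUnit (ofEntries y.2 0)}
  map_source' A hA := by
    refine ⟨?_, hA.2⟩
    change IsUnit (slice (lower (normalize (g⁻¹.1 * assemble A))))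
    rw [slice_lower (row_normalize hA.2)]
    exact isUnit_normalize (g⁻¹.isUnit.mul hA.1) hA.2
  map_target' y hy := by
    change IsUnit (g.1 * (slice y.1 * toeplitz (ofEntries y.2))) ∧
      IsUnit (row (g⁻¹.1 * (g.1 * (slice y.1 * toeplitz (ofEntries y.2)))) 0)
    rw [← Matrix.mul_assoc g⁻¹.1, Units.inv_mul, Matrix.one_mul, row_slice_mul_toeplitz]
    exact ⟨g.isUnit.mul (hy.1.mul ((isUnit_toeplitz _).2 hy.2)), hy.2⟩
  left_inv' A hA := by
    change columns (g.1 * (slice (lower (normalize (g⁻¹.1 * assemble A))) *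
      toeplitz (ofEntries (rowEntries (g⁻¹.1 * assemble A))))) = A
    rw [ofEntries_rowEntries, slice_mul_toeplitz hA.2, ← Matrix.mul_assoc, Units.mul_inv,
      Matrix.one_mul]
    rfl
  right_inv' y hy := by
    change (lower (normalize (g⁻¹.1 * (g.1 * (slice y.1 * toeplitz (ofEntries y.2))))),
      rowEntries (g⁻¹.1 * (g.1 * (slice y.1 * toeplitz (ofEntries y.2))))) = y
    rw [← Matrix.mul_assoc g⁻¹.1, Units.inv_mul, Matrix.one_mul, rowEntries_slice_mul_toeplitz,
      normalize_mul_toeplitz (slice y.1) (⟨ofEntries y.2, hy.2⟩ : JetGL k n), normalize_slice,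
      lower_slice]
  open_source := ((isOpen_isUnit _).preimage continuous_assemble).inter
    (isOpen_isUnit_row.preimage (continuous_const.matrix_mul continuous_assemble))
  open_target := ((isOpen_isUnit _).preimage (continuous_slice.comp continuous_fst)).inter
    ((isOpen_isUnit (Fin n)).preimage (f := fun y : SliceModel k n × (Fin k → Fin n → Fin n → ℝ) =>
      ofEntries y.2 0) ((continuous_apply (0 : Fin k)).comp continuous_snd))
  continuousOn_toFun := (contDiffOn_frameCoord g).continuousOn
  continuousOn_invFun := (contDiff_frameCoordSymm g).continuous.continuousOn

/-! ### Coordinates on `gl(kn)` adapted to the fundamental endomorphism -/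

/-- The matrices in the domain of `endModelChart`. -/
def endSource (g : GL (Fin k × Fin n) ℝ) : Set (EndModel k n) :=
  {Z | IsUnit (obs (g⁻¹.1 * Matrix.of Z * g.1))}

/-- The coordinates `(P, W)` of a matrix `Z = g P (N + W) P⁻¹ g⁻¹`, where `P` has first block row
`(I | 0 | ⋯ | 0)` and `W` is zero outside of the last block row. -/
noncomputable def endCoord (g : GL (Fin k × Fin n) ℝ) (Z : EndModel k n) :
    SliceModel k n × (Fin n → Fin k × Fin n → ℝ) :=
  (lower (obs (g⁻¹.1 * Matrix.of Z * g.1))⁻¹, last (defect (g⁻¹.1 * Matrix.of Z * g.1)))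

/-- The matrix with given coordinates. -/
noncomputable def endCoordSymm (g : GL (Fin k × Fin n) ℝ)
    (y : SliceModel k n × (Fin n → Fin k × Fin n → ℝ)) : EndModel k n :=
  Matrix.of.symm (g.1 * (slice y.1 * (nilp k n + lastRow y.2) * (slice y.1)⁻¹) * g⁻¹.1)

theorem contDiffOn_endCoord (g : GL (Fin k × Fin n) ℝ) :
    ContDiffOn ℝ ∞ (endCoord g) (endSource g) := by
  have h : ∀ p q, ContDiffOn ℝ ∞ (fun Z : EndModel k n => (g⁻¹.1 * Matrix.of Z * g.1) p q)
      (endSource g) :=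
    contDiffOn_conj (f := fun Z : EndModel k n => Matrix.of Z)
      (fun p q => (contDiff_apply_apply ℝ ℝ p q).contDiffOn) _ _
  refine (contDiffOn_pi.2 fun p => contDiffOn_pi.2 fun q => ?_).prodMk
    (contDiffOn_pi.2 fun a => contDiffOn_pi.2 fun q => ?_)
  · exact contDiffOn_inv_entry (contDiffOn_obs h) (fun Z hZ => hZ) (p.1.1, p.2) q
  · exact contDiffOn_defect h (fun Z hZ => hZ) _ q

theorem contDiffOn_endCoordSymm (g : GL (Fin k × Fin n) ℝ) :
    ContDiffOn ℝ ∞ (endCoordSymm g) {y | IsUnit (slice y.1)} := by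
  have h : ∀ p q, ContDiffOn ℝ ∞ (fun y : SliceModel k n × (Fin n → Fin k × Fin n → ℝ) =>
      slice y.1 p q) {y | IsUnit (slice y.1)} :=
    fun p q => ((contDiff_slice p q).comp contDiff_fst).contDiffOn
  refine contDiffOn_pi.2 fun p => contDiffOn_pi.2 fun q =>
    contDiffOn_conj (f := fun y : SliceModel k n × (Fin n → Fin k × Fin n → ℝ) =>
      slice y.1 * (nilp k n + lastRow y.2) * (slice y.1)⁻¹)
      (contDiffOn_mul_entry (f := fun y : SliceModel k n × (Fin n → Fin k × Fin n → ℝ) =>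
        slice y.1 * (nilp k n + lastRow y.2)) (g := fun y => (slice y.1)⁻¹)
        (contDiffOn_mul_entry (f := fun y : SliceModel k n × (Fin n → Fin k × Fin n → ℝ) =>
          slice y.1) (g := fun y => nilp k n + lastRow y.2) h fun i j => contDiffOn_const.add ?_)
        (contDiffOn_inv_entry h fun y hy => hy)) g.1 g⁻¹.1 p q
  simp only [lastRow, Matrix.of_apply]
  split_ifs
  · exact ((contDiff_apply_apply ℝ ℝ i.2 j).comp contDiff_snd).contDiffOn
  · exact contDiffOn_const

theorem continuous_obs_conj (P Q : Matrix (Fin k × Fin n) (Fin k × Fin n) ℝ) :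
    Continuous fun Z : EndModel k n => obs (P * Matrix.of Z * Q) :=
  continuous_obs.comp ((continuous_const.matrix_mul continuous_id).matrix_mul continuous_const)

theorem units_conj_conj {k n : ℕ} (g : GL (Fin k × Fin n) ℝ)
    (M : Matrix (Fin k × Fin n) (Fin k × Fin n) ℝ) :
    g⁻¹.1 * (g.1 * M * g⁻¹.1) * g.1 = M := by
  simp only [Matrix.mul_assoc]
  rw [Units.inv_mul, Matrix.mul_one, ← Matrix.mul_assoc, Units.inv_mul, Matrix.one_mul]

/-- Coordinates on `gl(kn)` in which the fundamental endomorphism becomes a linear inclusion. -/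
noncomputable def endModelChart (g : GL (Fin k × Fin n) ℝ) :
    OpenPartialHomeomorph (EndModel k n) (SliceModel k n × (Fin n → Fin k × Fin n → ℝ)) where
  toFun := endCoord g
  invFun := endCoordSymm g
  source := endSource g
  target := {y | IsUnit (slice y.1)}
  map_source' Z hZ := by
    change IsUnit (slice (lower (obs (g⁻¹.1 * Matrix.of Z * g.1))⁻¹))
    rw [slice_lower (row_inv hZ (row_obs _))]
    exact Matrix.isUnit_nonsing_inv_iff.2 hZ
  map_target' y hy := by
    change IsUnit (obs (g⁻¹.1 * (g.1 * (slice y.1 * (nilp k n + lastRow y.2) * (slice y.1)⁻¹) *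
      g⁻¹.1) * g.1))
    rw [units_conj_conj, obs_conj_slice hy (row_slice _)]
    exact Matrix.isUnit_nonsing_inv_iff.2 hy
  left_inv' Z hZ := by
    have hZ' : IsUnit (obs (g⁻¹.1 * Matrix.of Z * g.1)) := hZ
    change Matrix.of.symm (g.1 * (slice (lower (obs (g⁻¹.1 * Matrix.of Z * g.1))⁻¹) * (nilp k n +
      lastRow (last (defect (g⁻¹.1 * Matrix.of Z * g.1)))) *
      (slice (lower (obs (g⁻¹.1 * Matrix.of Z * g.1))⁻¹))⁻¹) * g⁻¹.1) = Z
    rw [slice_lower (row_inv hZ' (row_obs _)), lastRow_last_defect,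
      Matrix.nonsing_inv_nonsing_inv _ ((Matrix.isUnit_iff_isUnit_det _).1 hZ'), conj_defect hZ']
    have := units_conj_conj g⁻¹ (Matrix.of Z)
    rw [inv_inv] at this
    rw [this]
    rfl
  right_inv' y hy := by
    change (lower (obs (g⁻¹.1 * (g.1 * (slice y.1 * (nilp k n + lastRow y.2) * (slice y.1)⁻¹) *
      g⁻¹.1) * g.1))⁻¹, last (defect (g⁻¹.1 * (g.1 * (slice y.1 * (nilp k n + lastRow y.2) *
      (slice y.1)⁻¹) * g⁻¹.1) * g.1))) = y
    rw [units_conj_conj, obs_conj_slice hy (row_slice _), defect_conj hy (row_slice _),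
      Matrix.nonsing_inv_nonsing_inv _ ((Matrix.isUnit_iff_isUnit_det _).1 hy), lower_slice,
      last_lastRow]
  open_source := (isOpen_isUnit _).preimage (continuous_obs_conj g⁻¹.1 g.1)
  open_target := (isOpen_isUnit _).preimage (continuous_slice.comp continuous_fst)
  continuousOn_toFun := (contDiffOn_endCoord g).continuousOn
  continuousOn_invFun := (contDiffOn_endCoordSymm g).continuousOn

/-- Following a chart by a diffeomorphism between open sets gives a compatible chart. The linear map
`L` returns from the product, where the adapted coordinates live, to the model space. -/
theorem mem_maximalAtlas_of_contDiffOn {E F : Type*} [NormedAddCommGroup E] [NormedSpace ℝ E]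
    [NormedAddCommGroup F] [NormedSpace ℝ F] {M : Type*} [TopologicalSpace M] [ChartedSpace E M]
    [IsManifold 𝓘(ℝ, E) ∞ M] {c : OpenPartialHomeomorph M E}
    (hc : c ∈ IsManifold.maximalAtlas 𝓘(ℝ, E) ∞ M) (e : OpenPartialHomeomorph E F)
    (he : ContDiffOn ℝ ∞ e e.source) (he' : ContDiffOn ℝ ∞ e.symm e.target) (L : F ≃L[ℝ] E) :
    c ≫ₕ e ≫ₕ L.toHomeomorph.toOpenPartialHomeomorph ∈ IsManifold.maximalAtlas 𝓘(ℝ, E) ∞ M := by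
  apply OpenPartialHomeomorph.mem_maximalAtlas_of_contMDiffOn
  · have h1 : ContMDiffOn 𝓘(ℝ, E) 𝓘(ℝ, E) ∞ (L ∘ e) e.source :=
      (L.contDiff.comp_contDiffOn he).contMDiffOn
    exact h1.comp ((contMDiffOn_of_mem_maximalAtlas hc).mono (by simp)) (fun x hx => by simp_all)
  · have h1 : ContMDiffOn 𝓘(ℝ, E) 𝓘(ℝ, E) ∞ (e.symm ∘ L.symm) (L.symm ⁻¹' e.target) :=
      (he'.comp L.symm.contDiff.contDiffOn fun x hx => hx).contMDiffOn
    refine (contMDiffOn_symm_of_mem_maximalAtlas hc).comp (h1.mono fun x hx => ?_) fun x hx => ?_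
    · simp only [mfld_simps] at hx
      exact hx.1
    · simp only [mfld_simps] at hx
      exact hx.2

/-! ### Submersion, immersion, embedding, orbit and isotropy -/

namespace GrJet

theorem isSubmersion_mk :
    Manifold.IsSubmersion 𝓘(ℝ, FrameModel k n) 𝓘(ℝ, SliceModel k n) ∞
      (mk : FrameJet k n → GrJet k n) := by
  refine Manifold.IsSubmersionOfComplement.isSubmersion (F := Fin k → Fin n → Fin n → ℝ) fun A => ?_
  obtain ⟨g, hg⟩ := exists_mem_chartSource (mk A)
  let D := chartAt (FrameModel k n) A ≫ₕ frameModelChart g ≫ₕ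
    (frameEquiv k n).symm.toHomeomorph.toOpenPartialHomeomorph
  have hD : ∀ B, D B = (frameEquiv k n).symm (frameCoord g B.1) := fun B => rfl
  have hA : A ∈ D.source := by
    have h1 : (chartAt (FrameModel k n) A) A ∈ (frameModelChart g).source :=
      show A.1 ∈ frameSource g from ⟨isUnit_derivs A, hg⟩
    simp only [D, mfld_simps]
    exact h1
  refine Manifold.IsSubmersionAtOfComplement.mk_of_continuousAt
    isQuotientMap_mk.continuous.continuousAt (frameEquiv k n) D (chart g) hA hg
    (mem_maximalAtlas_of_contDiffOn (IsManifold.chart_mem_maximalAtlas A) (frameModelChart g)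
      (contDiffOn_frameCoord g) (contDiff_frameCoordSymm g).contDiffOn _)
    (IsManifold.subset_maximalAtlas ⟨g, rfl⟩) fun z hz => ?_
  have hz' : z ∈ D.target := by simpa only [mfld_simps] using hz
  have h := congrArg (frameEquiv k n) (D.right_inv hz')
  rw [hD, ContinuousLinearEquiv.apply_symm_apply] at h
  -- The chart of a span is by definition the first component of `frameCoord`.
  exact congrArg Prod.fst h

theorem fundEnd_mk (A : FrameJet k n) : fundEnd (mk A) = frameEnd A := rfl

theorem fundEnd_smul (T : GL (Fin k × Fin n) ℝ) (s : GrJet k n) :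
    fundEnd (T • s) = T.1 * fundEnd s * T⁻¹.1 :=
  Quotient.inductionOn s fun A => by
    change juxtapose (fun i => T.1 * derivs A i) * nilp k n *
      (juxtapose (fun i => T.1 * derivs A i))⁻¹ = T.1 * frameEnd A * T⁻¹.1
    rw [juxtapose_left_mul, Matrix.mul_inv_rev, frameEnd, Matrix.coe_units_inv]
    simp only [Matrix.mul_assoc]

theorem conj_fundEnd_mk (g : GL (Fin k × Fin n) ℝ) (A : FrameJet k n) :
    g⁻¹.1 * fundEnd (mk A) * g.1 =
      g⁻¹.1 * juxtapose (derivs A) * nilp k n * (g⁻¹.1 * juxtapose (derivs A))⁻¹ := by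
  rw [fundEnd_mk, frameEnd, Matrix.mul_inv_rev, ← Matrix.coe_units_inv, inv_inv]
  simp only [Matrix.mul_assoc]

theorem isUnit_obs_fundEnd (g : GL (Fin k × Fin n) ℝ) (s : GrJet k n) :
    IsUnit (obs (g⁻¹.1 * fundEnd s * g.1)) ↔ s ∈ (chart g).source :=
  Quotient.inductionOn s fun A => by
    change IsUnit (obs (g⁻¹.1 * fundEnd (mk A) * g.1)) ↔ _
    rw [conj_fundEnd_mk, isUnit_obs_conj_nilp (g⁻¹.isUnit.mul (isUnit_derivs A))]
    rfl

/-- For `Z = P N P⁻¹` the recursion holds in the last block row too, so the defect is zero, while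
the inverse of `obs Z` is the normalized frame defining the chart. -/
theorem endCoord_fundEnd (g : GL (Fin k × Fin n) ℝ) (s : GrJet k n) :
    endCoord g (fun p q => fundEnd s p q) = (chart g s, 0) :=
  Quotient.inductionOn s fun A => by
    change (lower (obs (g⁻¹.1 * fundEnd (mk A) * g.1))⁻¹,
      last (defect (g⁻¹.1 * fundEnd (mk A) * g.1))) = _
    have h := g⁻¹.isUnit.mul (isUnit_derivs A)
    rw [conj_fundEnd_mk, inv_obs_conj_nilp h, defect_conj_nilp h]
    rfl

theorem fundEnd_injective :
    Function.Injective (fundEnd : GrJet k n → Matrix (Fin k × Fin n) (Fin k × Fin n) ℝ) := by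
  intro s t h
  obtain ⟨g, hg⟩ := exists_mem_chartSource s
  -- Membership in a chart domain depends only on the endomorphism, so `s` and `t` share a chart.
  have hg' : t ∈ (chart g).source := by rwa [← isUnit_obs_fundEnd, ← h, isUnit_obs_fundEnd]
  refine (chart g).injOn hg hg' ?_
  have := endCoord_fundEnd g s
  rw [h, endCoord_fundEnd] at this
  exact (congrArg Prod.fst this).symm

theorem isImmersion_fundEnd :
    Manifold.IsImmersion 𝓘(ℝ, SliceModel k n) 𝓘(ℝ, EndModel k n) ∞
      (fun (s : GrJet k n) p q => fundEnd s p q) := by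
  refine Manifold.IsImmersionOfComplement.isImmersion (F := Fin n → Fin k × Fin n → ℝ) fun s => ?_
  obtain ⟨g, hg⟩ := exists_mem_chartSource s
  let D := OpenPartialHomeomorph.refl (EndModel k n) ≫ₕ endModelChart g ≫ₕ
    (endEquiv k n).toHomeomorph.toOpenPartialHomeomorph
  have hs : ∀ t ∈ (chart g).source, (fun p q => fundEnd t p q) ∈ D.source := by
    intro t ht
    have h1 : (fun p q => fundEnd t p q) ∈ (endModelChart g).source :=
      (isUnit_obs_fundEnd g t).2 ht
    simp only [D, mfld_simps]
    exact h1
  refine Manifold.IsImmersionAtOfComplement.mk_of_charts (endEquiv k n) (chart g) D hg (hs s hg)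
    (IsManifold.subset_maximalAtlas ⟨g, rfl⟩)
    (mem_maximalAtlas_of_contDiffOn (IsManifold.subset_maximalAtlas (by simp)) (endModelChart g)
      (contDiffOn_endCoord g) (contDiffOn_endCoordSymm g) _) hs fun y hy => ?_
  have hy' : y ∈ (chart g).target := by simpa using hy
  change endEquiv k n (endCoord g fun p q => fundEnd ((chart g).symm y) p q) = endEquiv k n (y, 0)
  rw [endCoord_fundEnd, (chart g).right_inv hy']

theorem continuous_fundEnd :
    Continuous fun (s : GrJet k n) p q => fundEnd s p q :=
  isImmersion_fundEnd.contMDiff.continuous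

theorem isEmbedding_fundEnd :
    Topology.IsEmbedding fun (s : GrJet k n) p q => fundEnd s p q := by
  refine ⟨Topology.isInducing_iff_nhds.2 fun s => ?_, fundEnd_injective⟩
  refine le_antisymm continuous_fundEnd.continuousAt.le_comap fun U hU => ?_
  obtain ⟨g, hg⟩ := exists_mem_chartSource s
  have hs : (fun p q => fundEnd s p q) ∈ endSource g := (isUnit_obs_fundEnd g s).2 hg
  have hsrc := (endModelChart g).open_source.mem_nhds hs
  -- This is a continuous local left inverse: drop the companion part `W` and apply the inverse
  -- chart.
  have hcont : ContinuousAt (fun Z => (chart g).symm (endCoord g Z).1)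
      (fun p q => fundEnd s p q) := by
    refine ContinuousAt.comp (g := (chart g).symm) ?_
      (continuous_fst.continuousAt.comp ((endModelChart g).continuousAt hs))
    rw [endCoord_fundEnd]
    exact (chart g).continuousAt_symm ((chart g).map_source hg)
  have hU' : U ∈ nhds ((chart g).symm (endCoord g fun p q => fundEnd s p q).1) := by
    rw [endCoord_fundEnd, (chart g).left_inv hg]
    exact hU
  -- Intersecting with `endSource g` forces every jet whose image is in the neighbourhood into the
  -- domain of `chart g`, so that the left inverse applies to jets not assumed close to `s`.
  refine ⟨_, Filter.inter_mem (hcont hU') hsrc, ?_⟩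
  rintro t ⟨ht, ht'⟩
  have ht1 : t ∈ (chart g).source := (isUnit_obs_fundEnd g t).1 ht'
  have ht2 : (chart g).symm (endCoord g fun p q => fundEnd t p q).1 ∈ U := ht
  rwa [endCoord_fundEnd, (chart g).left_inv ht1] at ht2

theorem range_fundEnd :
    Set.range (fundEnd : GrJet k n → Matrix (Fin k × Fin n) (Fin k × Fin n) ℝ) =
      {M | ∃ T : GL (Fin k × Fin n) ℝ, M = T.1 * nilp k n * T⁻¹.1} := by
  ext M
  constructor
  · rintro ⟨s, rfl⟩
    induction s using Quotient.inductionOn with | _ A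
    -- The conjugating matrix is the juxtaposed frame itself.
    obtain ⟨T, hT⟩ := isUnit_derivs A
    refine ⟨T, ?_⟩
    change frameEnd A = _
    rw [frameEnd, Matrix.coe_units_inv, hT]
  · rintro ⟨T, rfl⟩
    refine ⟨mk (frameOf T.1), ?_⟩
    rw [fundEnd_mk, frameEnd, juxtapose_frameOf T.isUnit, Matrix.coe_units_inv]

theorem smul_eq_self_iff (T : GL (Fin k × Fin n) ℝ) (s : GrJet k n) :
    T • s = s ↔ T.1 * fundEnd s * T⁻¹.1 = fundEnd s := by
  rw [← fundEnd_smul, fundEnd_injective.eq_iff]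

end GrJet

end FanningJets
theorem mainTheorem6 (n k : ℕ) [NeZero k] :
    -- The smooth structure on the space of jets of fanning curves is the quotient structure.
    Manifold.IsSubmersion 𝓘(ℝ, Fin k → Fin k × Fin n → Fin n → ℝ) 𝓘(ℝ, SliceModel k n) ∞
      (GrJet.mk : FrameJet k n → GrJet k n) ∧
    -- The fundamental endomorphism is equivariant for the adjoint action,
    (∀ (T : GL (Fin k × Fin n) ℝ) (s : GrJet k n),
      GrJet.fundEnd (T • s) =
        (T : Matrix (Fin k × Fin n) (Fin k × Fin n) ℝ) * GrJet.fundEnd s *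
          ((T⁻¹ : GL (Fin k × Fin n) ℝ) : Matrix (Fin k × Fin n) (Fin k × Fin n) ℝ)) ∧
    -- a smooth embedding into `gl(kn)` (with matrix entries as coordinates),
    Manifold.IsSmoothEmbedding 𝓘(ℝ, SliceModel k n)
      𝓘(ℝ, Fin k × Fin n → Fin k × Fin n → ℝ) ∞
      (fun (s : GrJet k n) p q => GrJet.fundEnd s p q) ∧
    -- whose image is an adjoint orbit,
    (∃ N : Matrix (Fin k × Fin n) (Fin k × Fin n) ℝ,
      Set.range (GrJet.fundEnd : GrJet k n → Matrix (Fin k × Fin n) (Fin k × Fin n) ℝ) =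
        {M | ∃ T : GL (Fin k × Fin n) ℝ,
          M = (T : Matrix (Fin k × Fin n) (Fin k × Fin n) ℝ) * N *
            ((T⁻¹ : GL (Fin k × Fin n) ℝ) : Matrix (Fin k × Fin n) (Fin k × Fin n) ℝ)}) ∧
    -- and a jet and its image have the same isotropy group.
    (∀ (T : GL (Fin k × Fin n) ℝ) (s : GrJet k n),
      T • s = s ↔
        (T : Matrix (Fin k × Fin n) (Fin k × Fin n) ℝ) * GrJet.fundEnd s *
          ((T⁻¹ : GL (Fin k × Fin n) ℝ) : Matrix (Fin k × Fin n) (Fin k × Fin n) ℝ) =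
            GrJet.fundEnd s) :=
  ⟨GrJet.isSubmersion_mk, GrJet.fundEnd_smul,
    ⟨GrJet.isImmersion_fundEnd, GrJet.isEmbedding_fundEnd⟩,
    -- The orbit is based at the endomorphism of the frame whose juxtaposed matrix is the identity.
    ⟨nilp k n, GrJet.range_fundEnd⟩, GrJet.smul_eq_self_iff⟩
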